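/- For a finite graph $G$ and an integer $r\ge 2$, an $r$-cut of $G$ is a partition of $V(G)$ into $r$ (possibly empty) parts, its size is the number of edges of $G$ with endpoints in different parts, and a maximum $r$-cut is an $r$-cut of largest size. Call two vertices equivalent if they lie in the same part of every maximum $r$-cut of $G$. If the $r$ largest equivalence classes have strictly more than $|V(G)|/(r+1)$ vertices each, these $r$ classes form the $(0,r)$-core of $G$; otherwise $G$ has no $(0,r)$-core. Let $x_r(G)$ be the number of vertices of $G$ that belong to no class of the $(0,r)$-core, so that $x_r(G)=|V(G)|$ if $G$ has no $(0,r)$-core. Let $G_{n,p}$ be the binomial random graph on $n$ vertices with edge probability $p$. **Proposition 2.13.** Let $r\ge 2$ be an integer and let $\delta>0$. There is a constant $c>0$, depending only on $r$ and $\delta$, such that for every sequence $p=p(n)\in[0,1]$ with $np\to\infty$ as $n\to\infty$ and with $p(n)\le 1-\delta$ for all large $n$, $$\mathbb{E}\big[x_r(G_{n,p})\big]\ \ge\ c\,\sqrt{n/p}\qquad\text{for all sufficiently large } n.$$ -/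

import Mathlib

namespace MaxCut

/-- The size of the `r`-cut `c` of `G`: the number of edges of `G` whose endpoints lie in different
parts. An `r`-cut is given by the map `c : V → Fin r` sending a vertex to the index of its part. -/
noncomputable def cutSize {V : Type*} (G : SimpleGraph V) {r : ℕ} (c : V → Fin r) : ℕ :=
  {e ∈ G.edgeSet | ¬ (Sym2.map c e).IsDiag}.ncard

/-- `b_r(G)`, the largest size of an `r`-cut of `G`. -/
noncomputable def maxCutSize {V : Type*} (G : SimpleGraph V) (r : ℕ) : ℕ :=
  ⨆ c : V → Fin r, cutSize G c

theorem cutSize_le_maxCutSize {V : Type*} [Finite V] (G : SimpleGraph V) {r : ℕ}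
    (c : V → Fin r) : cutSize G c ≤ maxCutSize G r :=
  le_ciSup (Set.finite_range fun c : V → Fin r => cutSize G c).bddAbove c

/-- The deficit of an `r`-cut of a finite graph. The subtraction does not truncate, by
`cutSize_le_maxCutSize`. -/
noncomputable def deficit {V : Type*} (G : SimpleGraph V) {r : ℕ} (c : V → Fin r) : ℕ :=
  maxCutSize G r - cutSize G c

/-- `(d,r)`-equivalence of vertices of `G`: being in the same part of every `r`-cut of deficit at
most `d`. -/
def cutSetoid {V : Type*} (G : SimpleGraph V) (d r : ℕ) : Setoid V where
  r u v := ∀ c : V → Fin r, deficit G c ≤ d → c u = c v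
  iseqv :=
    { refl := fun _ _ _ => rfl
      symm := fun h c hc => (h c hc).symm
      trans := fun h h' c hc => (h c hc).trans (h' c hc) }

/-- The `(d,r)`-components of `G` that have strictly more than `|V| / (r + 1)` vertices. There are
never more than `r` of these, as `r + 1` of them would have more than `|V|` vertices in total. -/
def largeComponents {V : Type*} (G : SimpleGraph V) (d r : ℕ) : Set (Set V) :=
  {C ∈ (cutSetoid G d r).classes | Nat.card V < (r + 1) * C.ncard}

/-- `G` has a `(d,r)`-core: its `r` largest `(d,r)`-components have strictly more than
`|V| / (r + 1)` vertices each. The core is then the family `largeComponents G d r`. -/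
def HasCore {V : Type*} (G : SimpleGraph V) (d r : ℕ) : Prop :=
  (largeComponents G d r).ncard = r

/-- `X_r(G)`, the set of vertices not belonging to (a member of) the `(0,r)`-core of `G`; this is
the set of all vertices if `G` has no `(0,r)`-core. -/
def outsideCore {V : Type*} (G : SimpleGraph V) (r : ℕ) : Set V :=
  {v | ¬ (HasCore G 0 r ∧ ∃ C ∈ largeComponents G 0 r, v ∈ C)}

/-- `x_r(G) = |X_r(G)|`. -/
noncomputable def outsideCoreCard {V : Type*} (G : SimpleGraph V) (r : ℕ) : ℕ :=
  (outsideCore G r).ncard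

end MaxCut

/-! The expected size of a maximum `r`-cut of `G_{n,p}` is bounded from both sides; the two bounds
agree to leading order, and the gap between them forces `x`, the expected number of vertices outside
the core, to be large.

Lower bound (`le_bernoulliExp_maxCutSize`): add the vertices one at a time, each to a part in which
it has fewest neighbours. The fluctuation of the numbers of neighbours in the parts beats a random
placement by order `√(k p (1 - p))` at the `k`-th vertex, hence by order `n √(n p (1 - p))` in
total.

Upper bound: an edge of a maximum cut either is separated by all maximum cuts (rigid) or is lost by
one of them. By `maxCutSize_le`, the edges of the second kind number at most a constant times the
degree sum over the vertices outside the core, whose mean is `O(n p x + n)` by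
`bernoulliExp_sum_degree_le`. For the first kind, resampling a single pair
(`bernoulliExp_card_rigidEdges_le`) gives at most `p` times the expected number of pairs split by
some maximum cut. Pairs inside a core class are never split, so `card_splitPairs_le` bounds the
number of split pairs by `(1 - 1/r) n² / 2 + n x_r / r`.

After cancelling the leading terms, `n √(n p (1 - p))` is `O(n p x + n)`. As `n p → ∞` and `1 - p ≥
δ`, this yields `x ≥ c √(n / p)`. -/

section

open Finset

namespace MaxCut

/-! ### Expectations over random subsets and binomial moments. -/

/-- The expectation of `f S`, where `S` is a random subset of `E` containing each element
independently with probability `p`. -/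
noncomputable def bernoulliExp {α : Type*} (E : Finset α) (p : ℝ) (f : Finset α → ℝ) : ℝ :=
  ∑ S ∈ E.powerset, p ^ #S * (1 - p) ^ (#E - #S) * f S

section bernoulliExp

variable {α : Type*} {E E₁ E₂ : Finset α} {p : ℝ} {f g : Finset α → ℝ}

theorem bernoulliExp_empty (p : ℝ) (f : Finset α → ℝ) : bernoulliExp ∅ p f = f ∅ := by
  simp [bernoulliExp]

theorem bernoulliExp_insert [DecidableEq α] {a : α} (ha : a ∉ E) (p : ℝ) (f : Finset α → ℝ) :
    bernoulliExp (insert a E) p f =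
      p * bernoulliExp E p (fun S => f (insert a S)) + (1 - p) * bernoulliExp E p f := by
  unfold bernoulliExp
  rw [sum_powerset_insert ha, mul_sum, mul_sum, add_comm]
  congr 1
  · refine sum_congr rfl fun S hS => ?_
    rw [mem_powerset] at hS
    rw [card_insert_of_notMem ha, card_insert_of_notMem fun h => ha (hS h),
      Nat.add_sub_add_right, pow_succ]
    ring
  · refine sum_congr rfl fun S hS => ?_
    rw [mem_powerset] at hS
    rw [card_insert_of_notMem ha, Nat.succ_sub (card_le_card hS), pow_succ]
    ring

theorem bernoulliExp_congr (h : ∀ S ⊆ E, f S = g S) : bernoulliExp E p f = bernoulliExp E p g :=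
  sum_congr rfl fun S hS => by rw [h S (mem_powerset.1 hS)]

theorem bernoulliExp_mono (hp : 0 ≤ p) (hp1 : p ≤ 1) (h : ∀ S ⊆ E, f S ≤ g S) :
    bernoulliExp E p f ≤ bernoulliExp E p g :=
  sum_le_sum fun S hS => mul_le_mul_of_nonneg_left (h S (mem_powerset.1 hS))
    (mul_nonneg (pow_nonneg hp _) (pow_nonneg (sub_nonneg.2 hp1) _))

theorem bernoulliExp_add (E : Finset α) (p : ℝ) (f g : Finset α → ℝ) :
    bernoulliExp E p (fun S => f S + g S) = bernoulliExp E p f + bernoulliExp E p g := by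
  simp only [bernoulliExp, mul_add, sum_add_distrib]

theorem bernoulliExp_const_mul (E : Finset α) (p k : ℝ) (f : Finset α → ℝ) :
    bernoulliExp E p (fun S => k * f S) = k * bernoulliExp E p f := by
  simp only [bernoulliExp, mul_sum]
  exact sum_congr rfl fun S _ => by ring

theorem bernoulliExp_sub (E : Finset α) (p : ℝ) (f g : Finset α → ℝ) :
    bernoulliExp E p (fun S => f S - g S) = bernoulliExp E p f - bernoulliExp E p g := by
  simp only [bernoulliExp, mul_sub, sum_sub_distrib]

theorem bernoulliExp_sum {ι : Type*} (E : Finset α) (p : ℝ) (T : Finset ι)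
    (f : ι → Finset α → ℝ) :
    bernoulliExp E p (fun S => ∑ i ∈ T, f i S) = ∑ i ∈ T, bernoulliExp E p (f i) := by
  simp only [bernoulliExp, mul_sum]
  exact sum_comm

theorem bernoulliExp_const (E : Finset α) (p k : ℝ) : bernoulliExp E p (fun _ => k) = k := by
  classical
  induction E using Finset.induction_on with
  | empty => exact bernoulliExp_empty _ _
  | insert a E ha ih => rw [bernoulliExp_insert ha, ih]; ring

theorem le_bernoulliExp {k : ℝ} (hp : 0 ≤ p) (hp1 : p ≤ 1) (h : ∀ S ⊆ E, k ≤ f S) :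
    k ≤ bernoulliExp E p f :=
  (bernoulliExp_const E p k).symm.trans_le (bernoulliExp_mono hp hp1 h)

theorem bernoulliExp_le {k : ℝ} (hp : 0 ≤ p) (hp1 : p ≤ 1) (h : ∀ S ⊆ E, f S ≤ k) :
    bernoulliExp E p f ≤ k :=
  (bernoulliExp_mono hp hp1 h).trans_eq (bernoulliExp_const E p k)

/-- Fubini for independent edge sets: this is how part of the randomness is conditioned on below. -/
theorem bernoulliExp_union [DecidableEq α] (h : Disjoint E₁ E₂) (p : ℝ) (f : Finset α → ℝ) :
    bernoulliExp (E₁ ∪ E₂) p f =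
      bernoulliExp E₁ p fun S => bernoulliExp E₂ p fun T => f (S ∪ T) := by
  induction E₂ using Finset.induction_on generalizing f with
  | empty => simp [bernoulliExp_empty]
  | insert a E₂ ha ih =>
    rw [disjoint_insert_right] at h
    rw [union_insert, bernoulliExp_insert (by simp [ha, h.1]), ih h.2, ih h.2]
    simp only [bernoulliExp_insert ha, union_insert, bernoulliExp_add, bernoulliExp_const_mul]

theorem abs_bernoulliExp_le (hp : 0 ≤ p) (hp1 : p ≤ 1) (E : Finset α) (f : Finset α → ℝ) :
    |bernoulliExp E p f| ≤ bernoulliExp E p fun S => |f S| := by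
  refine (abs_sum_le_sum_abs _ _).trans (le_of_eq (sum_congr rfl fun S _ => ?_))
  rw [abs_mul, abs_of_nonneg (mul_nonneg (pow_nonneg hp _) (pow_nonneg (sub_nonneg.2 hp1) _))]

theorem bernoulliExp_card_sub (E : Finset α) (p : ℝ) :
    bernoulliExp E p (fun S => (#S : ℝ) - p * #E) = 0 := by
  classical
  induction E using Finset.induction_on with
  | empty => simp [bernoulliExp_empty]
  | insert a E ha ih =>
    rw [bernoulliExp_insert ha, card_insert_of_notMem ha]
    have h1 : bernoulliExp E p (fun S => ((#(insert a S) : ℕ) : ℝ) - p * ((#E + 1 : ℕ) : ℝ)) =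
        bernoulliExp E p (fun S => ((#S : ℝ) - p * #E) + (1 - p)) :=
      bernoulliExp_congr fun S hS => by
        rw [card_insert_of_notMem fun h => ha (hS h)]; push_cast; ring
    have h2 : bernoulliExp E p (fun S => (#S : ℝ) - p * ((#E + 1 : ℕ) : ℝ)) =
        bernoulliExp E p (fun S => ((#S : ℝ) - p * #E) + (-p)) :=
      bernoulliExp_congr fun S hS => by push_cast; ring
    rw [h1, h2, bernoulliExp_add, bernoulliExp_add, bernoulliExp_const, bernoulliExp_const, ih]
    ring

theorem bernoulliExp_card (E : Finset α) (p : ℝ) :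
    bernoulliExp E p (fun S => (#S : ℝ)) = p * #E := by
  have h := bernoulliExp_card_sub E p
  rw [bernoulliExp_sub, bernoulliExp_const] at h
  linarith

theorem bernoulliExp_card_sub_sq (E : Finset α) (p : ℝ) :
    bernoulliExp E p (fun S => ((#S : ℝ) - p * #E) ^ 2) = #E * (p * (1 - p)) := by
  classical
  induction E using Finset.induction_on with
  | empty => simp [bernoulliExp_empty]
  | insert a E ha ih =>
    have h0 := bernoulliExp_card_sub E p
    rw [bernoulliExp_insert ha, card_insert_of_notMem ha]
    have h1 : bernoulliExp E p (fun S => (((#(insert a S) : ℕ) : ℝ) - p * ((#E + 1 : ℕ) : ℝ)) ^ 2) =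
        bernoulliExp E p (fun S => ((#S : ℝ) - p * #E) ^ 2 +
          (2 * (1 - p) * ((#S : ℝ) - p * #E) + (1 - p) ^ 2)) :=
      bernoulliExp_congr fun S hS => by
        rw [card_insert_of_notMem fun h => ha (hS h)]; push_cast; ring
    have h2 : bernoulliExp E p (fun S => ((#S : ℝ) - p * ((#E + 1 : ℕ) : ℝ)) ^ 2) =
        bernoulliExp E p (fun S => ((#S : ℝ) - p * #E) ^ 2 +
          (-2 * p * ((#S : ℝ) - p * #E) + p ^ 2)) :=
      bernoulliExp_congr fun S hS => by push_cast; ring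
    rw [h1, h2]
    simp only [bernoulliExp_add, bernoulliExp_const_mul, bernoulliExp_const, ih, h0]
    push_cast
    ring

/-- Adding one element, the cubic terms cancel on averaging and the linear ones have mean zero, so
the induction needs only the variance. -/
theorem bernoulliExp_card_sub_pow_four_le (hp : 0 ≤ p) (hp1 : p ≤ 1) (E : Finset α) :
    bernoulliExp E p (fun S => ((#S : ℝ) - p * #E) ^ 4) ≤
      3 * (#E * (p * (1 - p))) ^ 2 + #E * (p * (1 - p)) := by
  classical
  induction E using Finset.induction_on with
  | empty => simp [bernoulliExp_empty]
  | insert a E ha ih =>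
    have h0 := bernoulliExp_card_sub E p
    have hs := bernoulliExp_card_sub_sq E p
    rw [bernoulliExp_insert ha, card_insert_of_notMem ha]
    have h1 : bernoulliExp E p (fun S => (((#(insert a S) : ℕ) : ℝ) - p * ((#E + 1 : ℕ) : ℝ)) ^ 4) =
        bernoulliExp E p (fun S => ((#S : ℝ) - p * #E) ^ 4 +
          (4 * (1 - p) * ((#S : ℝ) - p * #E) ^ 3 + (6 * (1 - p) ^ 2 * ((#S : ℝ) - p * #E) ^ 2 +
          (4 * (1 - p) ^ 3 * ((#S : ℝ) - p * #E) + (1 - p) ^ 4)))) :=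
      bernoulliExp_congr fun S hS => by
        rw [card_insert_of_notMem fun h => ha (hS h)]; push_cast; ring
    have h2 : bernoulliExp E p (fun S => ((#S : ℝ) - p * ((#E + 1 : ℕ) : ℝ)) ^ 4) =
        bernoulliExp E p (fun S => ((#S : ℝ) - p * #E) ^ 4 +
          (-4 * p * ((#S : ℝ) - p * #E) ^ 3 + (6 * p ^ 2 * ((#S : ℝ) - p * #E) ^ 2 +
          (-4 * p ^ 3 * ((#S : ℝ) - p * #E) + p ^ 4)))) :=
      bernoulliExp_congr fun S hS => by push_cast; ring
    rw [h1, h2]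
    simp only [bernoulliExp_add, bernoulliExp_const_mul, bernoulliExp_const, hs, h0]
    have hq : 0 ≤ p * (1 - p) := mul_nonneg hp (sub_nonneg.2 hp1)
    have h3 : (0 : ℝ) ≤ (p * (1 - p)) ^ 2 := sq_nonneg _
    push_cast
    nlinarith [ih, hq, h3]

/-- The mean absolute deviation of a binomial random variable from any point is at least a
constant multiple of the standard deviation, provided the latter is at least one. -/
theorem sqrt_le_bernoulliExp_abs_card_sub (hp : 0 ≤ p) (hp1 : p ≤ 1) (E : Finset α) (t : ℝ)
    (hE : 1 ≤ #E * (p * (1 - p))) :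
    √(#E * (p * (1 - p))) / 4 ≤ bernoulliExp E p (fun S => |(#S : ℝ) - t|) := by
  set σ := √(#E * (p * (1 - p))) with hσ
  have hσ2 : σ ^ 2 = #E * (p * (1 - p)) := Real.sq_sqrt (by linarith)
  have hσ1 : 1 ≤ σ := Real.one_le_sqrt.2 hE
  -- A polynomial minorant of `|x|`, tangent to it at `|x| = 2σ`: with `|x| = 2σz` it says `z (z -
  -- 1)² (z + 2) ≥ 0`. Its mean involves only the second and fourth moments, and the latter is at
  -- most `3σ⁴ + σ² ≤ 4σ⁴` since `σ ≥ 1`.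
  have key : ∀ x : ℝ, 3 / (4 * σ) * x ^ 2 - 1 / (16 * σ ^ 3) * x ^ 4 ≤ |x| := by
    intro x
    have hx : x ^ 2 = |x| ^ 2 := (sq_abs x).symm
    have hx4 : x ^ 4 = |x| ^ 4 := by rw [show x ^ 4 = (x ^ 2) ^ 2 by ring, hx]; ring
    rw [hx, hx4]
    obtain ⟨z, hz⟩ : ∃ z, |x| = 2 * σ * z := ⟨|x| / (2 * σ), by field_simp⟩
    have hz0 : 0 ≤ z := by
      by_contra h
      have := abs_nonneg x
      nlinarith
    rw [hz]
    have : 3 / (4 * σ) * (2 * σ * z) ^ 2 - 1 / (16 * σ ^ 3) * (2 * σ * z) ^ 4 =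
        2 * σ * z - σ * (z * ((z - 1) ^ 2 * (z + 2))) := by
      field_simp
      ring
    rw [this]
    have : 0 ≤ σ * (z * ((z - 1) ^ 2 * (z + 2))) := by positivity
    linarith
  have hX : σ / 2 ≤ bernoulliExp E p (fun S => |(#S : ℝ) - p * #E|) := by
    have h4 := bernoulliExp_card_sub_pow_four_le hp hp1 E
    have h2 := bernoulliExp_card_sub_sq E p
    rw [← hσ2] at h4 h2
    refine le_trans ?_ (bernoulliExp_mono hp hp1 fun S _ => key _)
    rw [bernoulliExp_sub, bernoulliExp_const_mul, bernoulliExp_const_mul, h2]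
    have : 1 / (16 * σ ^ 3) * bernoulliExp E p (fun S => ((#S : ℝ) - p * #E) ^ 4) ≤
        1 / (16 * σ ^ 3) * (4 * σ ^ 4) := by
      refine mul_le_mul_of_nonneg_left (h4.trans ?_) (by positivity)
      nlinarith [mul_le_mul_of_nonneg_left (one_le_pow₀ (n := 2) hσ1) (sq_nonneg σ)]
    have h5 : 3 / (4 * σ) * σ ^ 2 - 1 / (16 * σ ^ 3) * (4 * σ ^ 4) = σ / 2 := by
      field_simp
      ring
    linarith
  -- Jensen. With the triangle inequality, replacing the mean by an arbitrary centre `t` costs a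
  -- factor of at most two.
  have ht : |p * #E - t| ≤ bernoulliExp E p (fun S => |(#S : ℝ) - t|) := by
    refine le_trans (le_of_eq ?_) (abs_bernoulliExp_le hp hp1 E _)
    rw [bernoulliExp_sub, bernoulliExp_const, bernoulliExp_card]
  have hle : bernoulliExp E p (fun S => |(#S : ℝ) - p * #E|) ≤
      bernoulliExp E p (fun S => |(#S : ℝ) - t| + |p * #E - t|) :=
    bernoulliExp_mono hp hp1 fun S _ => by
      rw [abs_sub_comm (p * (#E : ℝ)) t]; exact abs_sub_le _ _ _
  rw [bernoulliExp_add, bernoulliExp_const] at hle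
  linarith

end bernoulliExp

/-! ### The binomial random graph as a random set of edges. -/

/-- The set of all possible edges of a graph on `V`. -/
def allEdges (V : Type*) [Fintype V] [DecidableEq V] : Finset (Sym2 V) :=
  univ.filter fun e => ¬ e.IsDiag

theorem integral_binomialRandom {V : Type*} [Fintype V] [DecidableEq V] (p : unitInterval)
    (F : SimpleGraph V → ℝ) :
    ∫ G, F G ∂(SimpleGraph.binomialRandom V p) =
      bernoulliExp (allEdges V) p fun S => F (SimpleGraph.fromEdgeSet S) := by
  classical
  have : MeasurableSingletonClass (SimpleGraph V) := ⟨fun G => by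
    have : ({G} : Set (SimpleGraph V)) = SimpleGraph.edgeSet ⁻¹' {G.edgeSet} := by
      ext H; simp
    rw [this]
    exact SimpleGraph.measurable_edgeSet (measurableSet_singleton _)⟩
  rw [MeasureTheory.integral_fintype (.of_finite)]
  unfold bernoulliExp
  refine sum_bij' (fun G _ => G.edgeFinset) (fun S _ => SimpleGraph.fromEdgeSet (S : Set (Sym2 V)))
    ?_ ?_ ?_ ?_ ?_
  · intro G _
    rw [mem_powerset]
    intro e he
    simpa [allEdges] using G.not_isDiag_of_mem_edgeSet (SimpleGraph.mem_edgeFinset.1 he)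
  · simp
  · intro G _
    simp
  · intro S hS
    rw [mem_powerset] at hS
    ext e
    simp only [SimpleGraph.mem_edgeFinset, SimpleGraph.edgeSet_fromEdgeSet]
    constructor
    · intro h; simpa using h.1
    · intro h; exact ⟨by simpa using h, by simpa [allEdges] using hS h⟩
  · intro G _
    have hc : #(allEdges V) = (Nat.card V).choose 2 := by
      rw [Nat.card_eq_fintype_card, ← Sym2.card_diagSet_compl, Fintype.card_subtype]
      congr 1
    have hG : G.edgeSet.ncard = #G.edgeFinset := by
      rw [← SimpleGraph.coe_edgeFinset, Set.ncard_coe_finset]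
    rw [MeasureTheory.measureReal_def, SimpleGraph.binomialRandom_singleton, smul_eq_mul, hc, hG]
    simp

/-! ### Maximum cuts and their equivalence classes. -/

/-- The endpoints of the pair `e` lie in different parts of the cut `c`. -/
def Separates {V : Type*} {r : ℕ} (c : V → Fin r) (e : Sym2 V) : Prop :=
  ¬ (e.map c).IsDiag

/-- `c` is a maximum cut of `G`. -/
def IsMaxCut {V : Type*} (G : SimpleGraph V) {r : ℕ} (c : V → Fin r) : Prop :=
  ∀ c' : V → Fin r, cutSize G c' ≤ cutSize G c

section

variable {V : Type*} {r : ℕ}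

@[simp]
theorem separates_mk {c : V → Fin r} {u v : V} : Separates c s(u, v) ↔ c u ≠ c v := by
  simp [Separates]

theorem maxCutSize_eq_of_isMaxCut {G : SimpleGraph V} {c : V → Fin r} (hc : IsMaxCut G c) :
    maxCutSize G r = cutSize G c := by
  have : Nonempty (V → Fin r) := ⟨c⟩
  exact le_antisymm (ciSup_le hc) (le_ciSup (f := fun c : V → Fin r => cutSize G c)
    ⟨cutSize G c, by rintro _ ⟨c', rfl⟩; exact hc c'⟩ c)

theorem deficit_le_zero_iff [Finite V] {G : SimpleGraph V} {c : V → Fin r} :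
    deficit G c ≤ 0 ↔ IsMaxCut G c := by
  constructor
  · intro h c'
    have h1 := cutSize_le_maxCutSize G c'
    unfold deficit at h
    omega
  · intro h
    rw [deficit, maxCutSize_eq_of_isMaxCut h, Nat.sub_self]

theorem exists_isMaxCut [Finite V] (hr : 0 < r) (G : SimpleGraph V) :
    ∃ c : V → Fin r, IsMaxCut G c := by
  have : Nonempty (Fin r) := ⟨⟨0, hr⟩⟩
  exact Finite.exists_max fun c : V → Fin r => cutSize G c

theorem cutSetoid_zero_iff [Finite V] {G : SimpleGraph V} {u v : V} :
    cutSetoid G 0 r u v ↔ ∀ c : V → Fin r, IsMaxCut G c → c u = c v := by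
  simp only [← deficit_le_zero_iff]
  rfl

theorem outsideCore_eq_univ {G : SimpleGraph V} (h : ¬ HasCore G 0 r) :
    outsideCore G r = Set.univ := by
  simp [outsideCore, h]

theorem notMem_outsideCore {G : SimpleGraph V} {v : V} :
    v ∉ outsideCore G r ↔ HasCore G 0 r ∧ ∃ C ∈ largeComponents G 0 r, v ∈ C := by
  simp [outsideCore]

theorem mem_class_iff {s : Setoid V} {C : Set V} (hC : C ∈ s.classes) {u v : V} (hu : u ∈ C) :
    v ∈ C ↔ s u v := by
  obtain ⟨w, rfl⟩ := hC
  simp only [Set.mem_ofPred_eq] at hu ⊢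
  exact ⟨fun h => s.trans' hu (s.symm' h), fun h => s.trans' (s.symm' h) hu⟩

theorem eq_of_mem_class {s : Setoid V} {C C' : Set V} (hC : C ∈ s.classes) (hC' : C' ∈ s.classes)
    {u : V} (hu : u ∈ C) (hu' : u ∈ C') : C = C' := by
  ext v
  rw [mem_class_iff hC hu, mem_class_iff hC' hu']

end

/-! ### Deterministic bounds: split pairs, rigid edges and the core. -/

open scoped Classical in
/-- The pairs of vertices of `G` separated by some maximum `r`-cut. -/
noncomputable def splitPairs {V : Type*} [Fintype V] (G : SimpleGraph V) (r : ℕ) :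
    Finset (Sym2 V) :=
  (allEdges V).filter fun e => ∃ c : V → Fin r, IsMaxCut G c ∧ Separates c e

open scoped Classical in
/-- The edges of `G` separated by every maximum `r`-cut. -/
noncomputable def rigidEdges {V : Type*} [Fintype V] (G : SimpleGraph V) (r : ℕ) :
    Finset (Sym2 V) :=
  G.edgeFinset.filter fun e => ∀ c : V → Fin r, IsMaxCut G c → Separates c e

section

variable {V : Type*} [Fintype V] {r : ℕ}

open scoped Classical in
-- The split pairs are the edges of the graph of inequivalence, so this is the handshake lemma.
theorem two_mul_card_splitPairs (G : SimpleGraph V) :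
    2 * #(splitPairs G r) = ∑ u : V, #{v | ¬ cutSetoid G 0 r u v} := by
  let H : SimpleGraph V :=
    { Adj := fun u v => ¬ cutSetoid G 0 r u v
      symm := ⟨fun u v h h' => h ((cutSetoid G 0 r).symm h')⟩
      loopless := ⟨fun u h => h ((cutSetoid G 0 r).refl u)⟩ }
  have hH : splitPairs G r = H.edgeFinset := by
    ext e
    induction e with | _ u v =>
    simp only [splitPairs, allEdges, mem_filter, SimpleGraph.mem_edgeFinset,
      SimpleGraph.mem_edgeSet, H, cutSetoid_zero_iff, separates_mk, mem_univ, true_and,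
      Sym2.mk_isDiag_iff, not_forall, exists_prop, ne_eq]
    constructor
    · exact fun h => h.2
    · rintro ⟨c, hc, h⟩
      exact ⟨fun h' => h (h' ▸ rfl), c, hc, h⟩
  rw [hH, ← H.sum_degrees_eq_twice_card_edges]
  refine sum_congr rfl fun u _ => ?_
  rw [← SimpleGraph.card_neighborFinset_eq_degree]
  congr 1
  ext v
  simp [H]

/-- Few vertices outside the core force many pairs of vertices not separated by any maximum cut. -/
theorem card_splitPairs_le (hr : 0 < r) (G : SimpleGraph V) :
    2 * r * (#(splitPairs G r) : ℝ) ≤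
      (r - 1) * (Fintype.card V : ℝ) ^ 2 + 2 * Fintype.card V * outsideCoreCard G r := by
  classical
  have h2 := two_mul_card_splitPairs (r := r) G
  set n := Fintype.card V with hn
  have hr1 : (1 : ℝ) ≤ r := by exact_mod_cast hr
  by_cases hcore : HasCore G 0 r
  swap
  -- Without a core `x_r(G) = n`, and the trivial bound `n²` on ordered pairs suffices.
  · have hx : outsideCoreCard G r = n := by
      rw [outsideCoreCard, outsideCore_eq_univ hcore, Set.ncard_univ, Nat.card_eq_fintype_card]
    have h3 : 2 * #(splitPairs G r) ≤ n * n := by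
      rw [h2]
      refine (sum_le_card_nsmul _ _ n fun u _ => card_le_univ _).trans ?_
      simp [hn]
    have h4 : 2 * (#(splitPairs G r) : ℝ) ≤ n * n := by exact_mod_cast h3
    rw [hx]
    nlinarith [sq_nonneg (n : ℝ)]
  · have hfin : (largeComponents G 0 r).Finite := Set.toFinite _
    set L := hfin.toFinset with hL
    have hLc : #L = r := by
      rw [hL, ← Set.ncard_eq_toFinset_card _ hfin]
      exact hcore
    have hmem : ∀ C ∈ L, C ∈ (cutSetoid G 0 r).classes := fun C hC =>
      ((hfin.mem_toFinset).1 hC).1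
    have hdisj : (L : Set (Set V)).PairwiseDisjoint fun C => C.toFinset := by
      intro C hC C' hC' hne
      rw [Function.onFun, Finset.disjoint_left]
      intro v hv hv'
      exact hne (eq_of_mem_class (hmem C hC) (hmem C' hC') (Set.mem_toFinset.1 hv)
        (Set.mem_toFinset.1 hv'))
    have hX : (L.biUnion fun C => C.toFinset) = (outsideCore G r).toFinsetᶜ := by
      ext v
      simp only [mem_biUnion, Set.mem_toFinset, mem_compl, notMem_outsideCore, hL,
        Set.Finite.mem_toFinset, hcore, true_and]
    have hsum : (∑ C ∈ L, #C.toFinset) + outsideCoreCard G r = n := by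
      rw [← card_biUnion hdisj, hX, outsideCoreCard, Set.ncard_eq_toFinset_card',
        card_compl_add_card]
    -- A core class `C` contributes `|C|²` ordered equivalent pairs. By Cauchy–Schwarz the `r`
    -- classes, covering `n - x_r` vertices, contribute at least `(n - x_r)² / r`.
    have heq : ∑ C ∈ L, #C.toFinset ^ 2 ≤ ∑ u : V, #{v | cutSetoid G 0 r u v} := by
      calc ∑ C ∈ L, #C.toFinset ^ 2
          = ∑ C ∈ L, ∑ u ∈ C.toFinset, #{v | cutSetoid G 0 r u v} := by
            refine sum_congr rfl fun C hC => ?_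
            rw [sq, ← smul_eq_mul, ← sum_const]
            refine sum_congr rfl fun u hu => ?_
            congr 1
            ext v
            simp [mem_class_iff (hmem C hC) (Set.mem_toFinset.1 hu)]
        _ = ∑ u ∈ L.biUnion fun C => C.toFinset, #{v | cutSetoid G 0 r u v} :=
            (sum_biUnion hdisj).symm
        _ ≤ _ := sum_le_univ_sum_of_nonneg fun _ => Nat.zero_le _
    have hcs : (∑ C ∈ L, (#C.toFinset : ℝ)) ^ 2 ≤ r * ∑ C ∈ L, (#C.toFinset : ℝ) ^ 2 := by
      have := sq_sum_le_card_mul_sum_sq (s := L) (f := fun C => (#C.toFinset : ℝ))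
      rwa [hLc] at this
    have htot : (∑ u : V, #{v | cutSetoid G 0 r u v}) + ∑ u : V, #{v | ¬ cutSetoid G 0 r u v}
        = n * n := by
      rw [← sum_add_distrib]
      simp only [card_filter_add_card_filter_not]
      simp [hn]
    have e1 : (∑ C ∈ L, (#C.toFinset : ℝ)) + outsideCoreCard G r = n := by exact_mod_cast hsum
    have e2 : ∑ C ∈ L, (#C.toFinset : ℝ) ^ 2 ≤
        ((∑ u : V, #{v | cutSetoid G 0 r u v} : ℕ) : ℝ) := by exact_mod_cast heq
    have e3 : ((∑ u : V, #{v | cutSetoid G 0 r u v} : ℕ) : ℝ) + 2 * #(splitPairs G r) = n * n := by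
      rw [← h2] at htot
      exact_mod_cast htot
    have e4 : r * ∑ C ∈ L, (#C.toFinset : ℝ) ^ 2 ≤
        r * ((∑ u : V, #{v | cutSetoid G 0 r u v} : ℕ) : ℝ) :=
      mul_le_mul_of_nonneg_left e2 (by positivity)
    have e5 : ∑ C ∈ L, (#C.toFinset : ℝ) = n - outsideCoreCard G r := by linarith
    rw [e5] at hcs
    have e6 : ((∑ u : V, #{v | cutSetoid G 0 r u v} : ℕ) : ℝ) = n * n - 2 * #(splitPairs G r) := by
      linarith
    rw [e6] at e4
    nlinarith [sq_nonneg (outsideCoreCard G r : ℝ)]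

open scoped Classical in
theorem cutSize_eq_card (G : SimpleGraph V) (c : V → Fin r) :
    cutSize G c = #{e ∈ G.edgeFinset | Separates c e} := by
  rw [cutSize, ← Set.ncard_coe_finset, coe_filter]
  simp only [SimpleGraph.mem_edgeFinset, Separates]

open scoped Classical in
theorem cutSize_add_card_not_separates (G : SimpleGraph V) (c : V → Fin r) :
    cutSize G c + #{e ∈ G.edgeFinset | ¬ Separates c e} = #G.edgeFinset := by
  rw [cutSize_eq_card, card_filter_add_card_filter_not]

open scoped Classical in
-- Isolates the contribution of `v`, the only one affected when `v` is moved to another part.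
theorem card_not_separates_eq (G : SimpleGraph V) (c : V → Fin r) (v : V) :
    #{e ∈ G.edgeFinset | ¬ Separates c e} =
      #{e ∈ G.edgeFinset | v ∉ e ∧ ¬ Separates c e} + #{w ∈ G.neighborFinset v | c w = c v} := by
  rw [← card_filter_add_card_filter_not (s := {e ∈ G.edgeFinset | ¬ Separates c e}) (v ∉ ·),
    filter_filter, filter_filter]
  congr 1
  · congr 1
    ext e
    simp [and_comm]
  · rw [← card_image_of_injective {w ∈ G.neighborFinset v | c w = c v}
      (Sym2.mkEmbedding v).injective]
    congr 1
    ext e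
    simp only [mem_filter, SimpleGraph.mem_edgeFinset, not_not, mem_image,
      SimpleGraph.mem_neighborFinset, Sym2.mkEmbedding_apply]
    constructor
    · rintro ⟨he, hs, w, rfl⟩
      refine ⟨w, ⟨he, ?_⟩, rfl⟩
      simpa using (not_not.1 (separates_mk.not.1 hs)).symm
    · rintro ⟨w, ⟨hw, hc⟩, rfl⟩
      exact ⟨hw, by simp [hc], by simp⟩

open scoped Classical in
/-- In a maximum cut no vertex has more neighbours in its own part than in any other part. -/
theorem IsMaxCut.card_neighbors_le {G : SimpleGraph V} {c : V → Fin r} (hc : IsMaxCut G c) (v : V)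
    (i : Fin r) :
    #{w ∈ G.neighborFinset v | c w = c v} ≤ #{w ∈ G.neighborFinset v | c w = i} := by
  set c' := Function.update c v i with hc'
  have h1 := cutSize_add_card_not_separates G c
  have h2 := cutSize_add_card_not_separates G c'
  rw [card_not_separates_eq G _ v] at h1 h2
  have h3 : {e ∈ G.edgeFinset | v ∉ e ∧ ¬ Separates c e} =
      {e ∈ G.edgeFinset | v ∉ e ∧ ¬ Separates c' e} := by
    refine filter_congr fun e _ => and_congr_right fun hv => ?_
    induction e with | _ a b =>
    rw [Sym2.mem_iff, not_or] at hv
    simp [hc', Function.update_of_ne (Ne.symm hv.1), Function.update_of_ne (Ne.symm hv.2)]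
  have h4 : {w ∈ G.neighborFinset v | c' w = c' v} = {w ∈ G.neighborFinset v | c w = i} := by
    refine filter_congr fun w hw => ?_
    have : w ≠ v := ((G.mem_neighborFinset v w).1 hw).ne'
    simp [hc', Function.update_of_ne this]
  rw [h3] at h1
  rw [h4] at h2
  have := hc c'
  omega

open scoped Classical in
/-- If one part of a maximum cut is contained in `X`, then the number of edges inside its parts is
at most the sum of the degrees of the vertices in `X`. -/
theorem IsMaxCut.card_not_separates_le {G : SimpleGraph V} {c : V → Fin r} (hc : IsMaxCut G c)
    {X : Finset V} {i : Fin r} (hi : ∀ v, c v = i → v ∈ X) :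
    #{e ∈ G.edgeFinset | ¬ Separates c e} ≤ ∑ v ∈ X, G.degree v := by
  have h1 : {e ∈ G.edgeFinset | ¬ Separates c e} ⊆
      univ.biUnion fun v => {w ∈ G.neighborFinset v | c w = c v}.image fun w => s(v, w) := by
    intro e
    induction e with | _ a b =>
    intro he
    rw [mem_filter, separates_mk, not_not, SimpleGraph.mem_edgeFinset] at he
    rw [mem_biUnion]
    refine ⟨a, mem_univ _, mem_image.2 ⟨b, ?_, rfl⟩⟩
    rw [mem_filter, SimpleGraph.mem_neighborFinset]
    exact ⟨he.1, he.2.symm⟩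
  -- By maximality, neighbours in the own part may be replaced by neighbours in part `i`. Double
  -- counting then turns the sum into the degrees of the vertices of part `i`, all of which lie in
  -- `X`.
  calc #{e ∈ G.edgeFinset | ¬ Separates c e}
      ≤ ∑ v, #({w ∈ G.neighborFinset v | c w = c v}.image fun w => s(v, w)) :=
        (card_le_card h1).trans card_biUnion_le
    _ ≤ ∑ v, #{w ∈ G.neighborFinset v | c w = i} :=
        sum_le_sum fun v _ => card_image_le.trans (hc.card_neighbors_le v i)
    _ = ∑ v, ∑ w, if G.Adj v w ∧ c w = i then 1 else 0 := by
        refine sum_congr rfl fun v _ => ?_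
        rw [← card_filter]
        congr 1
        ext w
        simp
    _ = ∑ w, ∑ v, if G.Adj v w ∧ c w = i then 1 else 0 := sum_comm
    _ ≤ ∑ w, if w ∈ X then G.degree w else 0 := by
        refine sum_le_sum fun w _ => ?_
        by_cases hw : c w = i
        · rw [if_pos (hi w hw), ← card_filter, ← SimpleGraph.card_neighborFinset_eq_degree]
          refine card_le_card fun v hv => ?_
          simp only [mem_filter, mem_univ, true_and] at hv
          simpa using hv.1.symm
        · simp [hw]
    _ = ∑ v ∈ X, G.degree v := by simp

open scoped Classical in
-- Every core class is monochromatic under `c`. If each of the `r` colours occurred in the core,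
-- choosing a class for each colour would be a bijection onto the `r` classes, and distinct classes
-- could not share a colour.
theorem IsMaxCut.exists_color_notMem_core {G : SimpleGraph V} {c : V → Fin r} (hc : IsMaxCut G c)
    (hcore : HasCore G 0 r) {C C' : Set V} (hC : C ∈ largeComponents G 0 r)
    (hC' : C' ∈ largeComponents G 0 r) (hne : C ≠ C') {u v : V} (hu : u ∈ C) (hv : v ∈ C')
    (huv : c u = c v) : ∃ i, ∀ w, c w = i → w ∈ outsideCore G r := by
  by_contra! hall
  simp only [notMem_outsideCore] at hall
  choose w hw using hall
  have hw1 := fun i => (hw i).1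
  choose D hD hwD using fun i => (hw i).2.2
  have hDinj : Function.Injective fun i => (⟨D i, hD i⟩ : largeComponents G 0 r) := by
    intro i j hij
    have hij : D i = D j := congrArg Subtype.val hij
    rw [← hw1 i, ← hw1 j]
    exact cutSetoid_zero_iff.1
      ((mem_class_iff (hD i).1 (hwD i)).1 (hij ▸ hwD j)) c hc
  have hcard : Fintype.card (largeComponents G 0 r) = r := by
    rw [← Nat.card_eq_fintype_card, Nat.card_coe_set_eq]
    exact hcore
  have hbij := (Fintype.bijective_iff_injective_and_card _).2 ⟨hDinj, by simp [hcard]⟩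
  obtain ⟨i, hi⟩ := hbij.2 ⟨C, hC⟩
  obtain ⟨j, hj⟩ := hbij.2 ⟨C', hC'⟩
  have hi : D i = C := congrArg Subtype.val hi
  have hj : D j = C' := congrArg Subtype.val hj
  have h1 : c (w i) = c u := cutSetoid_zero_iff.1
      ((mem_class_iff (hD i).1 (hwD i)).1 (hi ▸ hu)) c hc
  have h2 : c (w j) = c v := cutSetoid_zero_iff.1
      ((mem_class_iff (hD j).1 (hwD j)).1 (hj ▸ hv)) c hc
  rw [hw1] at h1 h2
  have : i = j := by rw [h1, h2, huv]
  exact hne (by rw [← hi, ← hj, this])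

open scoped Classical in
/-- The number of edges of `G` separated by some but not all maximum cuts is bounded in terms of
the degrees of the vertices outside the core. -/
theorem maxCutSize_le (hr : 0 < r) (G : SimpleGraph V) :
    maxCutSize G r ≤ #(rigidEdges G r) +
      (1 + r ^ 2) * ∑ v ∈ (outsideCore G r).toFinset, G.degree v := by
  obtain ⟨c, hc⟩ := exists_isMaxCut hr G
  set X := (outsideCore G r).toFinset with hX
  set D := ∑ v ∈ X, G.degree v with hD
  set L := (largeComponents G 0 r).toFinset with hL
  set B : Finset (Sym2 V) := {e ∈ G.edgeFinset | Separates c e ∧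
    ∃ c' : V → Fin r, IsMaxCut G c' ∧ ¬ Separates c' e} with hB
  set F : Set V × Set V → Finset (Sym2 V) := fun P =>
    {e ∈ B | ∃ u ∈ P.1, ∃ v ∈ P.2, e = s(u, v)} with hF
  have hcut : cutSize G c ≤ #(rigidEdges G r) + #B := by
    rw [cutSize_eq_card]
    refine (card_le_card fun e he => ?_).trans (card_union_le _ _)
    rw [mem_filter] at he
    by_cases h : ∀ c' : V → Fin r, IsMaxCut G c' → Separates c' e
    · exact mem_union_left _ (mem_filter.2 ⟨he.1, h⟩)
    · push Not at h
      exact mem_union_right _ (mem_filter.2 ⟨he.1, he.2, h⟩)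
  -- An edge of `B` either meets the outside of the core or joins two core classes. The second
  -- family of edges is needed only if there is a core, and then `L` has exactly `r` members.
  have hsub : B ⊆ (X.biUnion fun v => G.incidenceFinset v) ∪
      ((if HasCore G 0 r then L ×ˢ L else ∅).biUnion F) := by
    intro e
    induction e with | _ u v =>
    intro he
    have heG : s(u, v) ∈ G.edgeSet := SimpleGraph.mem_edgeFinset.1 (mem_filter.1 he).1
    rw [mem_union, mem_biUnion, mem_biUnion]
    by_cases hu : u ∈ outsideCore G r
    · exact Or.inl ⟨u, by simpa [hX] using hu, by simpa [SimpleGraph.incidenceSet] using heG⟩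
    by_cases hv : v ∈ outsideCore G r
    · exact Or.inl ⟨v, by simpa [hX] using hv, by simpa [SimpleGraph.incidenceSet] using heG⟩
    rw [notMem_outsideCore] at hu hv
    obtain ⟨hcore, C, hC, huC⟩ := hu
    obtain ⟨-, C', hC', hvC⟩ := hv
    refine Or.inr ⟨(C, C'), ?_, mem_filter.2 ⟨he, u, huC, v, hvC, rfl⟩⟩
    simp [hcore, hL, hC, hC']
  have h1 : #(X.biUnion fun v => G.incidenceFinset v) ≤ D := by
    refine card_biUnion_le.trans (le_of_eq (sum_congr rfl fun v _ => ?_))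
    exact G.card_incidenceFinset_eq_degree v
  have h2 : #((if HasCore G 0 r then L ×ˢ L else ∅).biUnion F) ≤ r ^ 2 * D := by
    split_ifs with hcore
    swap
    · simp
    have hLr : #L = r := by
      rw [hL, ← Set.ncard_eq_toFinset_card']
      exact hcore
    have : #(L ×ˢ L) = r ^ 2 := by rw [card_product, hLr, sq]
    rw [← this]
    refine card_biUnion_le_card_mul _ _ _ fun P hP => ?_
    rw [mem_product, hL, Set.mem_toFinset, Set.mem_toFinset] at hP
    rcases (F P).eq_empty_or_nonempty with h0 | ⟨e, he⟩
    · simp [h0]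
    obtain ⟨heB, u, hu, v, hv, rfl⟩ := mem_filter.1 he
    -- One edge between the two classes that is lost by a maximum cut `c'` shows that `c'` gives
    -- both classes the same colour. So `c'` loses all edges between them, and one of its parts
    -- avoids the core, which bounds the number of edges it loses by `D`.
    obtain ⟨heG, hsep, c', hc', hmono⟩ := mem_filter.1 heB
    rw [separates_mk] at hsep hmono
    rw [not_not] at hmono
    have hne : P.1 ≠ P.2 := by
      intro h
      exact hsep (cutSetoid_zero_iff.1 ((mem_class_iff hP.1.1 hu).1 (h ▸ hv)) c hc)
    obtain ⟨i, hi⟩ := hc'.exists_color_notMem_core hcore hP.1 hP.2 hne hu hv hmono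
    refine (card_le_card fun e he => ?_).trans
      (hc'.card_not_separates_le (X := X) (i := i) fun w hw => by simpa [hX] using hi w hw)
    obtain ⟨heB, a, ha, b, hb, rfl⟩ := mem_filter.1 he
    refine mem_filter.2 ⟨(mem_filter.1 heB).1, ?_⟩
    rw [separates_mk, not_not,
      ← cutSetoid_zero_iff.1 ((mem_class_iff hP.1.1 hu).1 ha) c' hc', hmono,
      cutSetoid_zero_iff.1 ((mem_class_iff hP.2.1 hv).1 hb) c' hc']
  have h3 := (card_le_card hsub).trans (card_union_le _ _)
  rw [maxCutSize_eq_of_isMaxCut hc]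
  calc cutSize G c ≤ #(rigidEdges G r) + #B := hcut
    _ ≤ #(rigidEdges G r) + (D + r ^ 2 * D) := by omega
    _ = _ := by ring

end

/-! ### The effect of a single edge on the maximum cuts. -/

section

variable {V : Type*} {r : ℕ}

open scoped Classical in
theorem cutSize_fromEdgeSet (S : Finset (Sym2 V)) (c : V → Fin r) :
    cutSize (SimpleGraph.fromEdgeSet (S : Set (Sym2 V))) c = #{e ∈ S | Separates c e} := by
  rw [cutSize, ← Set.ncard_coe_finset, coe_filter]
  congr 1
  ext e
  induction e with | _ u v =>
  simp only [SimpleGraph.edgeSet_fromEdgeSet, Set.mem_ofPred_eq, Set.mem_sdiff, mem_coe, Separates]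
  refine ⟨fun h => ⟨h.1.1, h.2⟩, fun h => ⟨⟨h.1, fun h' => h.2 ?_⟩, h.2⟩⟩
  have : u = v := by simpa using h'
  simp [this]

/-- The possible edges between `v` and `W`. -/
def star (v : V) (W : Finset V) : Finset (Sym2 V) :=
  W.map (Sym2.mkEmbedding v)

@[simp]
theorem mem_star {v : V} {W : Finset V} {e : Sym2 V} : e ∈ star v W ↔ ∃ w ∈ W, s(v, w) = e := by
  simp [star]

theorem mk_mem_star {v w : V} {W : Finset V} : s(v, w) ∈ star v W ↔ w ∈ W :=
  mem_map' (Sym2.mkEmbedding v)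

theorem card_star (v : V) (W : Finset V) : #(star v W) = #W := card_map _

variable [DecidableEq V]

open scoped Classical in
theorem cutSize_fromEdgeSet_insert {S : Finset (Sym2 V)} {e : Sym2 V} (he : e ∉ S)
    (c : V → Fin r) :
    cutSize (SimpleGraph.fromEdgeSet ((insert e S : Finset (Sym2 V)) : Set (Sym2 V))) c =
      cutSize (SimpleGraph.fromEdgeSet (S : Set (Sym2 V))) c + if Separates c e then 1 else 0 := by
  rw [cutSize_fromEdgeSet, cutSize_fromEdgeSet, filter_insert]
  split_ifs with h
  · rw [card_insert_of_notMem fun h' => he (mem_filter.1 h').1]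
  · rw [add_zero]

/-- A maximum cut separating `e` gains one from the new edge, and no cut gains more. -/
theorem exists_separates_insert {S : Finset (Sym2 V)} {e : Sym2 V} (he : e ∉ S)
    (h : ∃ c : V → Fin r, IsMaxCut (SimpleGraph.fromEdgeSet (S : Set (Sym2 V))) c ∧
      Separates c e) :
    ∃ c : V → Fin r, IsMaxCut
      (SimpleGraph.fromEdgeSet ((insert e S : Finset (Sym2 V)) : Set (Sym2 V))) c ∧
      Separates c e := by
  obtain ⟨c, hc, hs⟩ := h
  refine ⟨c, fun c' => ?_, hs⟩
  have := hc c'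
  rw [cutSize_fromEdgeSet_insert he, cutSize_fromEdgeSet_insert he, if_pos hs]
  split_ifs <;> omega

variable [Fintype V]

/-- If no maximum cut separates `e`, the cuts that do are smaller by at least one. Adding `e` lets
them at best tie, so an old maximum cut stays maximum without separating `e`. -/
theorem exists_separates_of_forall_insert (hr : 0 < r) {S : Finset (Sym2 V)} {e : Sym2 V}
    (he : e ∉ S) (h : ∀ c : V → Fin r, IsMaxCut
      (SimpleGraph.fromEdgeSet ((insert e S : Finset (Sym2 V)) : Set (Sym2 V))) c →
      Separates c e) :
    ∃ c : V → Fin r, IsMaxCut (SimpleGraph.fromEdgeSet (S : Set (Sym2 V))) c ∧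
      Separates c e := by
  by_contra! hno
  obtain ⟨c, hc⟩ := exists_isMaxCut hr (SimpleGraph.fromEdgeSet (S : Set (Sym2 V)))
  refine hno c hc (h c fun c' => ?_)
  rw [cutSize_fromEdgeSet_insert he, cutSize_fromEdgeSet_insert he, if_neg (hno c hc)]
  have h1 := hc c'
  split_ifs with hs
  · have : cutSize (SimpleGraph.fromEdgeSet (S : Set (Sym2 V))) c' ≠
        cutSize (SimpleGraph.fromEdgeSet (S : Set (Sym2 V))) c := by
      intro heq
      exact hno c' (fun c'' => heq ▸ hc c'') hs
    omega
  · omega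

/-- The expected number of edges separated by all maximum cuts is at most `p` times the expected
number of pairs of vertices separated by some maximum cut. -/
theorem bernoulliExp_card_rigidEdges_le {p : ℝ} (hp : 0 ≤ p) (hp1 : p ≤ 1) (hr : 0 < r) :
    bernoulliExp (allEdges V) p (fun S : Finset (Sym2 V) => (#(rigidEdges (SimpleGraph.fromEdgeSet (S : Set (Sym2 V))) r) : ℝ)) ≤
      p * bernoulliExp (allEdges V) p
        (fun S : Finset (Sym2 V) =>
          (#(splitPairs (SimpleGraph.fromEdgeSet (S : Set (Sym2 V))) r) : ℝ)) := by
  classical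
  have h1 : bernoulliExp (allEdges V) p
      (fun S : Finset (Sym2 V) => (#(rigidEdges (SimpleGraph.fromEdgeSet (S : Set (Sym2 V))) r) : ℝ)) =
      bernoulliExp (allEdges V) p (fun S => ∑ e ∈ allEdges V, if e ∈ S ∧ ∀ c : V → Fin r,
        IsMaxCut (SimpleGraph.fromEdgeSet (S : Set (Sym2 V))) c → Separates c e
        then (1 : ℝ) else 0) := by
    refine bernoulliExp_congr fun S hS => ?_
    rw [sum_boole]
    congr 2
    ext e
    simp only [rigidEdges, mem_filter, SimpleGraph.mem_edgeFinset,
      SimpleGraph.edgeSet_fromEdgeSet, Set.mem_sdiff, mem_coe]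
    constructor
    · rintro ⟨⟨h, -⟩, h'⟩
      exact ⟨hS h, h, h'⟩
    · rintro ⟨h, h', h''⟩
      exact ⟨⟨h', by simpa [allEdges] using h⟩, h''⟩
  have h2 : bernoulliExp (allEdges V) p
      (fun S : Finset (Sym2 V) => (#(splitPairs (SimpleGraph.fromEdgeSet (S : Set (Sym2 V))) r) : ℝ)) =
      bernoulliExp (allEdges V) p (fun S => ∑ e ∈ allEdges V, if ∃ c : V → Fin r,
        IsMaxCut (SimpleGraph.fromEdgeSet (S : Set (Sym2 V))) c ∧ Separates c e
        then (1 : ℝ) else 0) := by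
    refine bernoulliExp_congr fun S hS => ?_
    rw [sum_boole]
    congr 2
    ext e
    simp [splitPairs, allEdges]
  rw [h1, h2, bernoulliExp_sum, bernoulliExp_sum, mul_sum]
  refine sum_le_sum fun e he => ?_
  rw [← insert_erase he, bernoulliExp_insert (notMem_erase _ _),
    bernoulliExp_insert (notMem_erase _ _)]
  set E := (allEdges V).erase e with hE
  have hnot : ∀ S ⊆ E, e ∉ S := fun S hS h => by simpa [hE] using hS h
  -- All pairs other than `e` are fixed, and `J` is the probability that `e` is split when absent.
  -- Then `e` is rigid with probability at most `p * J`, while it is split with probability at least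
  -- `p * J + (1 - p) * J = J`.
  set J := bernoulliExp E p fun S => if ∃ c : V → Fin r,
    IsMaxCut (SimpleGraph.fromEdgeSet (S : Set (Sym2 V))) c ∧ Separates c e then (1 : ℝ) else 0
    with hJ
  have h3 : J ≤ bernoulliExp E p fun S => if ∃ c : V → Fin r, IsMaxCut
      (SimpleGraph.fromEdgeSet ((insert e S : Finset (Sym2 V)) : Set (Sym2 V))) c ∧
      Separates c e then (1 : ℝ) else 0 := by
    refine bernoulliExp_mono hp hp1 fun S hS => ?_
    split_ifs with h h' h'
    · exact le_rfl
    · exact absurd (exists_separates_insert (hnot S hS) h) h'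
    · exact zero_le_one
    · exact le_rfl
  have h4 : (bernoulliExp E p fun S => if e ∈ insert e S ∧ ∀ c : V → Fin r, IsMaxCut
      (SimpleGraph.fromEdgeSet ((insert e S : Finset (Sym2 V)) : Set (Sym2 V))) c →
      Separates c e then (1 : ℝ) else 0) ≤ J := by
    refine bernoulliExp_mono hp hp1 fun S hS => ?_
    split_ifs with h h' h'
    · exact le_rfl
    · exact absurd (exists_separates_of_forall_insert hr (hnot S hS) h.2) h'
    · exact zero_le_one
    · exact le_rfl
  have h5 : (bernoulliExp E p fun S => if e ∈ S ∧ ∀ c : V → Fin r, IsMaxCut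
      (SimpleGraph.fromEdgeSet (S : Set (Sym2 V))) c → Separates c e then (1 : ℝ) else 0) = 0 :=
    (bernoulliExp_congr fun S hS => if_neg fun h => hnot S hS h.1).trans
      (bernoulliExp_const E p 0)
  rw [h5, mul_zero, add_zero]
  refine mul_le_mul_of_nonneg_left ?_ hp
  nlinarith

/-! ### The greedy lower bound for the maximum cut. -/

/-- The possible edges with both endpoints in `W`. -/
def edgesIn (W : Finset V) : Finset (Sym2 V) :=
  (allEdges V).filter fun e => ∀ v ∈ e, v ∈ W

theorem mk_mem_edgesIn {W : Finset V} {u v : V} :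
    s(u, v) ∈ edgesIn W ↔ u ≠ v ∧ u ∈ W ∧ v ∈ W := by
  simp [edgesIn, allEdges]

theorem edgesIn_univ : edgesIn (univ : Finset V) = allEdges V := by
  simp [edgesIn]

theorem edgesIn_insert {v : V} {W : Finset V} (hv : v ∉ W) :
    edgesIn (insert v W) = edgesIn W ∪ star v W := by
  ext e
  induction e with | _ a b =>
  rw [mem_union, mk_mem_edgesIn, mk_mem_edgesIn, mem_star]
  constructor
  · rintro ⟨hne, ha, hb⟩
    rw [mem_insert] at ha hb
    rcases ha with rfl | ha <;> rcases hb with rfl | hb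
    · exact absurd rfl hne
    · exact Or.inr ⟨b, hb, rfl⟩
    · exact Or.inr ⟨a, ha, Sym2.eq_swap⟩
    · exact Or.inl ⟨hne, ha, hb⟩
  · rintro (⟨hne, ha, hb⟩ | ⟨w, hw, h⟩)
    · exact ⟨hne, mem_insert_of_mem ha, mem_insert_of_mem hb⟩
    · have hne : v ≠ w := fun h => hv (h ▸ hw)
      rcases Sym2.eq_iff.1 h with ⟨rfl, rfl⟩ | ⟨rfl, rfl⟩
      · exact ⟨hne, mem_insert_self _ _, mem_insert_of_mem hw⟩
      · exact ⟨hne.symm, mem_insert_of_mem hw, mem_insert_self _ _⟩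

theorem disjoint_edgesIn_star {v : V} {W : Finset V} (hv : v ∉ W) :
    Disjoint (edgesIn W) (star v W) := by
  rw [Finset.disjoint_left]
  intro e he he'
  obtain ⟨w, hw, rfl⟩ := mem_star.1 he'
  exact hv (mk_mem_edgesIn.1 he).2.1

/-- Placing `v` in part `l` loses only the new edges from `v` to that part. -/
theorem maxCutSize_add_card_le {v : V} {W : Finset V} (hv : v ∉ W) {S T : Finset (Sym2 V)}
    (hS : S ⊆ edgesIn W) (hT : T ⊆ star v W) {c : V → Fin r}
    (hc : IsMaxCut (SimpleGraph.fromEdgeSet (S : Set (Sym2 V))) c) (l : Fin r) :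
    maxCutSize (SimpleGraph.fromEdgeSet (S : Set (Sym2 V))) r + #T ≤
      maxCutSize (SimpleGraph.fromEdgeSet ((S ∪ T : Finset (Sym2 V)) : Set (Sym2 V))) r +
        #(T ∩ star v {w ∈ W | c w = l}) := by
  classical
  have hdisj : Disjoint S T :=
    (disjoint_edgesIn_star hv).mono hS hT
  have h1 := cutSize_le_maxCutSize
    (SimpleGraph.fromEdgeSet ((S ∪ T : Finset (Sym2 V)) : Set (Sym2 V))) (Function.update c v l)
  rw [cutSize_fromEdgeSet, filter_union,
    card_union_of_disjoint (disjoint_filter_filter hdisj)] at h1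
  rw [maxCutSize_eq_of_isMaxCut hc, cutSize_fromEdgeSet]
  have h2 : {e ∈ S | Separates (Function.update c v l) e} = {e ∈ S | Separates c e} := by
    refine filter_congr fun e he => ?_
    induction e with | _ a b =>
    obtain ⟨-, ha, hb⟩ := mk_mem_edgesIn.1 (hS he)
    have ha : a ≠ v := fun h => hv (h ▸ ha)
    have hb : b ≠ v := fun h => hv (h ▸ hb)
    simp [ha, hb]
  have h3 : {e ∈ T | ¬ Separates (Function.update c v l) e} ⊆ T ∩ star v {w ∈ W | c w = l} := by
    intro e he
    obtain ⟨heT, hes⟩ := mem_filter.1 he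
    obtain ⟨w, hw, rfl⟩ := mem_star.1 (hT heT)
    have hwv : w ≠ v := fun h => hv (h ▸ hw)
    rw [separates_mk, not_not] at hes
    simp only [Function.update_self, Function.update_of_ne hwv] at hes
    exact mem_inter.2 ⟨heT, mk_mem_star.2 (mem_filter.2 ⟨hw, hes.symm⟩)⟩
  have h4 := card_le_card h3
  have h5 := card_filter_add_card_filter_not (s := T) (fun e => Separates (Function.update c v l) e)
  rw [h2] at h1
  omega

/-- Placing `v` in its best part gains `|d i - d j| / r` over the average placement. With `a = M - m
- #T`, every `a + d l` is nonnegative, so a single one is at most their sum `r * a + ∑ l, d l`;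
subtracting another one leaves the difference. -/
theorem maxCutSize_add_abs_le {v : V} {W : Finset V} (hv : v ∉ W) {S T : Finset (Sym2 V)}
    (hS : S ⊆ edgesIn W) (hT : T ⊆ star v W) {c : V → Fin r}
    (hc : IsMaxCut (SimpleGraph.fromEdgeSet (S : Set (Sym2 V))) c) (i j : Fin r) :
    r * (maxCutSize (SimpleGraph.fromEdgeSet (S : Set (Sym2 V))) r : ℝ) + (r - 1) * #T +
      |(#(T ∩ star v {w ∈ W | c w = i}) : ℝ) - #(T ∩ star v {w ∈ W | c w = j})| ≤
      r * (maxCutSize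
        (SimpleGraph.fromEdgeSet ((S ∪ T : Finset (Sym2 V)) : Set (Sym2 V))) r : ℝ) := by
  set m := maxCutSize (SimpleGraph.fromEdgeSet (S : Set (Sym2 V))) r
  set M := maxCutSize (SimpleGraph.fromEdgeSet ((S ∪ T : Finset (Sym2 V)) : Set (Sym2 V))) r
  set d : Fin r → ℕ := fun l => #(T ∩ star v {w ∈ W | c w = l}) with hd
  have hle : ∀ l, (m : ℝ) + #T ≤ M + d l := fun l => by
    exact_mod_cast maxCutSize_add_card_le hv hS hT hc l
  have hsum : ∑ l, d l ≤ #T := by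
    rw [hd, ← card_biUnion]
    · exact card_le_card (biUnion_subset.2 fun l _ => inter_subset_left)
    · intro a _ b _ hab
      refine Finset.disjoint_left.2 fun e he he' => ?_
      obtain ⟨w, hw, rfl⟩ := mem_star.1 (mem_inter.1 he).2
      have hw' := mk_mem_star.1 (mem_inter.1 he').2
      exact hab (by rw [← (mem_filter.1 hw).2, ← (mem_filter.1 hw').2])
  have hsum' : ∑ l, (d l : ℝ) ≤ #T := by exact_mod_cast hsum
  have htot : ∀ k : Fin r, (M : ℝ) - m - #T + d k ≤ r * ((M : ℝ) - m - #T) + ∑ l, (d l : ℝ) := by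
    intro k
    have := single_le_sum (f := fun l => (M : ℝ) - m - #T + d l) (s := univ)
      (fun l _ => by linarith [hle l]) (mem_univ k)
    rwa [sum_add_distrib, sum_const, card_univ, Fintype.card_fin, nsmul_eq_mul] at this
  have h1 := htot i
  have h2 := htot j
  have h3 := hle i
  have h4 := hle j
  have habs : |(d i : ℝ) - d j| ≤ r * ((M : ℝ) - m - #T) + ∑ l, (d l : ℝ) := by
    rw [abs_le]
    constructor <;> linarith
  change _ + |(d i : ℝ) - d j| ≤ _
  linarith

/-- The guaranteed gain when a vertex is added greedily to a maximum cut of a random graph on `k`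
vertices. -/
noncomputable def greedyGain (r : ℕ) (p : ℝ) (k : ℕ) : ℝ :=
  -- The deviation bound needs variance at least one on a part of size `k / r`; for smaller `k` no
  -- gain is claimed.
  if r ≤ k * (p * (1 - p)) then √(k * (p * (1 - p)) / r) / (4 * r) else 0

theorem maxCutSize_add_greedyGain_le {p : ℝ} (hp : 0 ≤ p) (hp1 : p ≤ 1) (hr : 2 ≤ r) {v : V}
    {W : Finset V} (hv : v ∉ W) {S : Finset (Sym2 V)} (hS : S ⊆ edgesIn W) :
    (maxCutSize (SimpleGraph.fromEdgeSet (S : Set (Sym2 V))) r : ℝ) +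
      ((1 - 1 / r) * p * #W + greedyGain r p #W) ≤
      bernoulliExp (star v W) p fun T => (maxCutSize
        (SimpleGraph.fromEdgeSet ((S ∪ T : Finset (Sym2 V)) : Set (Sym2 V))) r : ℝ) := by
  have hr0 : (0 : ℝ) < r := by positivity
  have hq : 0 ≤ p * (1 - p) := mul_nonneg hp (sub_nonneg.2 hp1)
  obtain ⟨c, hc⟩ := exists_isMaxCut (by omega : 0 < r) (SimpleGraph.fromEdgeSet (S : Set (Sym2 V)))
  have : Nonempty (Fin r) := ⟨⟨0, by omega⟩⟩
  obtain ⟨i, hi⟩ : ∃ i : Fin r, (#W : ℝ) / r ≤ #{w ∈ W | c w = i} := by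
    by_contra! h
    have h1 : ∑ i : Fin r, (#{w ∈ W | c w = i} : ℝ) < ∑ i : Fin r, (#W : ℝ) / r :=
      sum_lt_sum_of_nonempty univ_nonempty fun i _ => h i
    have h2 : (#W : ℝ) = ∑ i : Fin r, (#{w ∈ W | c w = i} : ℝ) := by
      exact_mod_cast card_eq_sum_card_fiberwise (f := c) (t := univ) fun _ _ => by simp
    rw [← h2] at h1
    simp only [sum_const, card_univ, Fintype.card_fin, nsmul_eq_mul] at h1
    rw [mul_div_cancel₀ _ hr0.ne'] at h1
    exact lt_irrefl _ h1
  have : Nontrivial (Fin r) := Fin.nontrivial_iff_two_le.2 hr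
  obtain ⟨j, hj⟩ := exists_ne i
  set A := star v {w ∈ W | c w = i} with hA
  set A' := star v {w ∈ W | ¬ c w = i} with hA'
  set B := star v {w ∈ W | c w = j} with hB
  have hunion : star v W = A' ∪ A := by
    rw [hA, hA', star, star, star, ← map_union, union_comm, filter_union_filter_not_eq]
  have hdisj : Disjoint A' A := by
    rw [hA, hA', star, star, disjoint_map]
    exact (disjoint_filter_filter_not _ _ _).symm
  have hBA : Disjoint A B := by
    rw [hA, hB, star, star, disjoint_map, Finset.disjoint_left]
    intro w hw hw'
    exact hj ((mem_filter.1 hw').2.symm.trans (mem_filter.1 hw).2)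
  have hgain : r * greedyGain r p #W ≤
      bernoulliExp (star v W) p fun T => |(#(T ∩ A) : ℝ) - #(T ∩ B)| := by
    rw [greedyGain]
    split_ifs with hk
    swap
    · rw [mul_zero]
      exact le_bernoulliExp hp hp1 fun _ _ => abs_nonneg _
    have hAk : #W * (p * (1 - p)) / r ≤ #A * (p * (1 - p)) := by
      rw [hA, card_star, mul_div_right_comm]
      exact mul_le_mul_of_nonneg_right hi hq
    have hA1 : 1 ≤ #A * (p * (1 - p)) := le_trans ((one_le_div hr0).2 hk) hAk
    -- Conditioning on the edges from `v` to vertices outside part `i` fixes the number going to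
    -- part `j`. The number going to part `i` is still binomial, so its deviation from that fixed
    -- value can be bounded below.
    rw [hunion, bernoulliExp_union hdisj]
    refine le_bernoulliExp hp hp1 fun T' hT' => ?_
    have : (r : ℝ) * (√(#W * (p * (1 - p)) / r) / (4 * r)) = √(#W * (p * (1 - p)) / r) / 4 := by
      field_simp
    rw [this]
    calc √(#W * (p * (1 - p)) / r) / 4 ≤ √(#A * (p * (1 - p))) / 4 := by gcongr
      _ ≤ bernoulliExp A p (fun T => |(#T : ℝ) - #(T' ∩ B)|) :=
        sqrt_le_bernoulliExp_abs_card_sub hp hp1 A _ hA1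
      _ = _ := by
        refine bernoulliExp_congr fun T hT => ?_
        have e1 : (T' ∪ T) ∩ A = T := by
          rw [union_inter_distrib_right, disjoint_iff_inter_eq_empty.1 (hdisj.mono_left hT'),
            empty_union, inter_eq_left.2 hT]
        have e2 : (T' ∪ T) ∩ B = T' ∩ B := by
          rw [union_inter_distrib_right, disjoint_iff_inter_eq_empty.1 (hBA.mono_left hT),
            union_empty]
        rw [e1, e2]
  have hmain := bernoulliExp_mono hp hp1 (E := star v W) fun T hT =>
    maxCutSize_add_abs_le hv hS hT hc i j
  simp only [bernoulliExp_const_mul, bernoulliExp_add, bernoulliExp_const, bernoulliExp_card,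
    card_star] at hmain
  refine le_of_mul_le_mul_left (le_trans (le_of_eq_of_le ?_ (add_le_add_right hgain
    (r * (maxCutSize (SimpleGraph.fromEdgeSet (S : Set (Sym2 V))) r : ℝ) +
      (r - 1) * (p * #W)))) hmain) hr0
  field_simp
  ring

/-- The vertices are revealed one at a time: the star of the new vertex is independent of the graph
on the earlier ones. -/
theorem sum_greedyGain_le {p : ℝ} (hp : 0 ≤ p) (hp1 : p ≤ 1) (hr : 2 ≤ r) (W : Finset V) :
    ∑ k ∈ range #W, ((1 - 1 / r) * p * k + greedyGain r p k) ≤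
      bernoulliExp (edgesIn W) p fun S =>
        (maxCutSize (SimpleGraph.fromEdgeSet (S : Set (Sym2 V))) r : ℝ) := by
  induction W using Finset.induction_on with
  | empty =>
    rw [card_empty, range_zero, sum_empty]
    exact le_bernoulliExp hp hp1 fun _ _ => Nat.cast_nonneg _
  | insert v W hv ih =>
    rw [card_insert_of_notMem hv, sum_range_succ, edgesIn_insert hv,
      bernoulliExp_union (disjoint_edgesIn_star hv)]
    refine le_trans (add_le_add_left ih _) ?_
    rw [← bernoulliExp_const (edgesIn W) p ((1 - 1 / r) * p * #W + _), ← bernoulliExp_add]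
    exact bernoulliExp_mono hp hp1 fun S hS => maxCutSize_add_greedyGain_le hp hp1 hr hv hS

/-- A random graph is expected to have a cut that is better than the random one by an amount of
order `n * √(n * p)`. -/
theorem le_bernoulliExp_maxCutSize {p : ℝ} (hp : 0 ≤ p) (hp1 : p ≤ 1) (hr : 2 ≤ r)
    (hn : 2 ≤ Fintype.card V) (hnp : 2 * r ≤ Fintype.card V * (p * (1 - p))) :
    (1 - 1 / r) * p * (Fintype.card V * (Fintype.card V - 1) / 2) +
      Fintype.card V / 3 * (√(Fintype.card V * (p * (1 - p)) / (2 * r)) / (4 * r)) ≤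
      bernoulliExp (allEdges V) p fun S =>
        (maxCutSize (SimpleGraph.fromEdgeSet (S : Set (Sym2 V))) r : ℝ) := by
  have h := sum_greedyGain_le hp hp1 hr (univ : Finset V)
  rw [edgesIn_univ, card_univ, sum_add_distrib, ← mul_sum] at h
  set n := Fintype.card V with hnV
  have hr0 : (0 : ℝ) < r := by positivity
  have hq : 0 ≤ p * (1 - p) := mul_nonneg hp (sub_nonneg.2 hp1)
  have hid : ∀ m : ℕ, ∑ k ∈ range m, (k : ℝ) = m * (m - 1) / 2 := by
    intro m
    induction m with
    | zero => simp
    | succ m ih => rw [sum_range_succ, ih]; push_cast; ring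
  rw [hid] at h
  refine le_trans (add_le_add_right ?_ _) h
  have hpos : ∀ k, 0 ≤ greedyGain r p k := fun k => by
    unfold greedyGain; split_ifs <;> positivity
  -- Only the steps with `k ≥ n / 2` are kept. Their number `⌊n / 2⌋` is at least `n / 3` because `n
  -- ≥ 2`, and on each the gain is at least its value at `n / 2`.
  have hsub : Ico ((n + 1) / 2) n ⊆ range n := by
    intro k hk
    rw [mem_Ico] at hk
    exact mem_range.2 hk.2
  refine le_trans ?_ (sum_le_sum_of_subset_of_nonneg hsub fun k _ _ => hpos k)
  have hterm : ∀ k ∈ Ico ((n + 1) / 2) n,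
      √(n * (p * (1 - p)) / (2 * r)) / (4 * r) ≤ greedyGain r p k := by
    intro k hk
    rw [mem_Ico] at hk
    have h2k : (n : ℝ) ≤ 2 * k := by exact_mod_cast (by omega : n ≤ 2 * k)
    have h3 : n * (p * (1 - p)) ≤ 2 * (k * (p * (1 - p))) := by
      nlinarith [mul_le_mul_of_nonneg_right h2k hq]
    have hk : (r : ℝ) ≤ k * (p * (1 - p)) := by linarith
    rw [greedyGain, if_pos hk]
    gcongr ?_ / _
    refine Real.sqrt_le_sqrt ?_
    rw [div_le_div_iff₀ (by positivity) hr0]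
    nlinarith
  have h4 := card_nsmul_le_sum _ _ _ hterm
  rw [nsmul_eq_mul, Nat.card_Ico] at h4
  refine le_trans (mul_le_mul_of_nonneg_right ?_ (by positivity)) h4
  have : (n : ℝ) ≤ 3 * ((n - (n + 1) / 2 : ℕ) : ℝ) := by
    exact_mod_cast (by omega : n ≤ 3 * (n - (n + 1) / 2))
  linarith

/-! ### Degree sums over a random vertex set. -/

open scoped Classical in
/-- The degrees of the vertices of a random set are on average not much larger than the mean. -/
theorem bernoulliExp_sum_degree_le {p : ℝ} (hp : 0 < p) (hp1 : p ≤ 1)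
    (hn : 2 ≤ Fintype.card V) (X : Finset (Sym2 V) → Finset V) :
    bernoulliExp (allEdges V) p (fun S => ((∑ v ∈ X S,
      (SimpleGraph.fromEdgeSet (S : Set (Sym2 V))).degree v : ℕ) : ℝ)) ≤
      2 * (Fintype.card V * p) * bernoulliExp (allEdges V) p (fun S => #(X S)) +
        2 * Fintype.card V := by
  set n := Fintype.card V with hnV
  have hn1 : (1 : ℝ) ≤ n - 1 := by
    have : (2 : ℝ) ≤ n := by exact_mod_cast hn
    linarith
  set μ : ℝ := p * (n - 1 : ℕ) with hμ
  have hcast : ((n - 1 : ℕ) : ℝ) = n - 1 := by rw [Nat.cast_sub (by omega)]; simp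
  have hμ0 : 0 < μ := by rw [hμ, hcast]; positivity
  set N : V → Finset (Sym2 V) := fun v => star v (univ.erase v) with hN
  have hNc : ∀ v, #(N v) = n - 1 := fun v => by
    rw [hN]; simp only [card_star]; rw [card_erase_of_mem (mem_univ v), card_univ]
  have hdeg : ∀ (S : Finset (Sym2 V)) (v : V), (SimpleGraph.fromEdgeSet (S : Set (Sym2 V))).degree v = #(S ∩ N v) := by
    intro S v
    rw [← SimpleGraph.card_neighborFinset_eq_degree, ← card_map (Sym2.mkEmbedding v)]
    congr 1
    ext e
    simp only [mem_map, SimpleGraph.mem_neighborFinset, SimpleGraph.fromEdgeSet_adj,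
      Sym2.mkEmbedding_apply, mem_inter, hN, mem_star, mem_erase, mem_univ, and_true, mem_coe]
    constructor
    · rintro ⟨w, ⟨h1, h2⟩, rfl⟩
      exact ⟨h1, w, h2.symm, rfl⟩
    · rintro ⟨h1, w, h2, rfl⟩
      exact ⟨w, ⟨h1, h2.symm⟩, rfl⟩
  have hvar : ∀ v, bernoulliExp (allEdges V) p (fun S => ((#(S ∩ N v) : ℝ) - μ) ^ 2) ≤ μ := by
    intro v
    have hv : v ∉ univ.erase v := notMem_erase _ _
    rw [← edgesIn_univ, ← insert_erase (mem_univ v), edgesIn_insert hv,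
      bernoulliExp_union (disjoint_edgesIn_star hv)]
    refine bernoulliExp_le hp.le hp1 fun S hS => ?_
    have : bernoulliExp (N v) p (fun T => ((#((S ∪ T) ∩ N v) : ℝ) - μ) ^ 2) =
        bernoulliExp (N v) p (fun T => ((#T : ℝ) - p * #(N v)) ^ 2) := by
      refine bernoulliExp_congr fun T hT => ?_
      rw [union_inter_distrib_right,
        disjoint_iff_inter_eq_empty.1 ((disjoint_edgesIn_star hv).mono_left hS),
        empty_union, inter_eq_left.2 hT, hNc]
    refine le_of_eq_of_le this ?_
    rw [bernoulliExp_card_sub_sq, hNc, hμ]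
    nlinarith [mul_nonneg hp.le (Nat.cast_nonneg (α := ℝ) (n - 1)),
      mul_nonneg hp.le (mul_nonneg hp.le (Nat.cast_nonneg (α := ℝ) (n - 1)))]
  -- `X S` may depend on the graph in any way, so large degrees are charged to a quadratic error.
  -- This error is summed over all vertices, where the variances total at most `n * μ`.
  have hpt : ∀ x : ℝ, x ≤ 2 * μ + 2 / μ * (x - μ) ^ 2 := by
    intro x
    have : 2 * μ + 2 / μ * (x - μ) ^ 2 - x = ((2 * x - 5 / 2 * μ) ^ 2 + 7 / 4 * μ ^ 2) / (2 * μ) := by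
      field_simp
      ring
    have h : 0 ≤ ((2 * x - 5 / 2 * μ) ^ 2 + 7 / 4 * μ ^ 2) / (2 * μ) := by positivity
    linarith
  have hbound : ∀ S ⊆ allEdges V, ((∑ v ∈ X S,
      (SimpleGraph.fromEdgeSet (S : Set (Sym2 V))).degree v : ℕ) : ℝ) ≤
      2 * (n * p) * #(X S) + 2 / μ * ∑ v, ((#(S ∩ N v) : ℝ) - μ) ^ 2 := by
    intro S _
    push_cast
    calc ∑ v ∈ X S, ((SimpleGraph.fromEdgeSet (S : Set (Sym2 V))).degree v : ℝ)
        ≤ ∑ v ∈ X S, (2 * μ + 2 / μ * ((#(S ∩ N v) : ℝ) - μ) ^ 2) :=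
          sum_le_sum fun v _ => by rw [hdeg]; exact hpt _
      _ = 2 * μ * #(X S) + 2 / μ * ∑ v ∈ X S, ((#(S ∩ N v) : ℝ) - μ) ^ 2 := by
          rw [sum_add_distrib, sum_const, nsmul_eq_mul, mul_comm (#(X S) : ℝ), mul_sum]
      _ ≤ _ := by
          gcongr
          · rw [hμ, hcast]; nlinarith
          · exact subset_univ _
  refine (bernoulliExp_mono hp.le hp1 hbound).trans ?_
  rw [bernoulliExp_add, bernoulliExp_const_mul, bernoulliExp_const_mul, bernoulliExp_sum]
  refine add_le_add_right ?_ _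
  have h1 : ∑ v : V, bernoulliExp (allEdges V) p (fun S => ((#(S ∩ N v) : ℝ) - μ) ^ 2) ≤ n * μ := by
    refine (sum_le_sum fun v _ => hvar v).trans ?_
    simp [hnV]
  calc _ ≤ 2 / μ * (n * μ) := mul_le_mul_of_nonneg_left h1 (by positivity)
    _ = 2 * n := by field_simp

end

/-! ### Combining the two bounds. -/

theorem sqrt_le_bernoulliExp_outsideCoreCard {V : Type*} [Fintype V] [DecidableEq V] {r : ℕ}
    {p : ℝ} (hp : 0 < p) (hp1 : p ≤ 1) (hr : 2 ≤ r) (hn : 2 ≤ Fintype.card V)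
    (hnp : (12 * (4 * r * (1 + r ^ 2) + r)) ^ 2 ≤
      Fintype.card V * (p * (1 - p)) / (2 * (r : ℝ))) :
    √(Fintype.card V * (p * (1 - p)) / (2 * r)) ≤
      12 * (4 * r * (1 + r ^ 2) + r) * p * bernoulliExp (allEdges V) p fun S =>
        (outsideCoreCard (SimpleGraph.fromEdgeSet (S : Set (Sym2 V))) r : ℝ) := by
  classical
  set n := Fintype.card V with hnV
  set s := √(n * (p * (1 - p)) / (2 * r)) with hs
  set K : ℝ := 4 * r * (1 + r ^ 2) + r with hK
  set x := bernoulliExp (allEdges V) p fun S =>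
    (outsideCoreCard (SimpleGraph.fromEdgeSet (S : Set (Sym2 V))) r : ℝ) with hx
  have hr2 : (2 : ℝ) ≤ r := by exact_mod_cast hr
  have hr0 : (0 : ℝ) < r := by linarith
  have hn0 : (0 : ℝ) < n := by exact_mod_cast (by omega : 0 < n)
  have hK1 : 1 ≤ K := by
    have : 0 ≤ 4 * (r : ℝ) * (1 + r ^ 2) := by positivity
    linarith
  have hs12 : 12 * K ≤ s := Real.le_sqrt_of_sq_le hnp
  have hx0 : 0 ≤ x := le_bernoulliExp hp.le hp1 fun _ _ => Nat.cast_nonneg _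
  have hlower := le_bernoulliExp_maxCutSize (V := V) hp.le hp1 hr hn (by
    have h1 : 1 ≤ n * (p * (1 - p)) / (2 * (r : ℝ)) := by nlinarith
    exact (one_le_div (by positivity)).1 h1)
  have hupper := bernoulliExp_mono hp.le hp1 (E := allEdges V)
    (f := fun S => (maxCutSize (SimpleGraph.fromEdgeSet (S : Set (Sym2 V))) r : ℝ))
    (g := fun S => (#(rigidEdges (SimpleGraph.fromEdgeSet (S : Set (Sym2 V))) r) : ℝ) +
      (1 + r ^ 2) * ((∑ v ∈ (outsideCore (SimpleGraph.fromEdgeSet (S : Set (Sym2 V))) r).toFinset,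
        (SimpleGraph.fromEdgeSet (S : Set (Sym2 V))).degree v : ℕ) : ℝ)) (fun S _ => by
      have h : maxCutSize (SimpleGraph.fromEdgeSet (S : Set (Sym2 V))) r ≤
          #(rigidEdges (SimpleGraph.fromEdgeSet (S : Set (Sym2 V))) r) + (1 + r ^ 2) *
            ∑ v ∈ (outsideCore (SimpleGraph.fromEdgeSet (S : Set (Sym2 V))) r).toFinset,
              (SimpleGraph.fromEdgeSet (S : Set (Sym2 V))).degree v := by
        convert maxCutSize_le (by omega : 0 < r) _
      exact_mod_cast h)
  rw [bernoulliExp_add, bernoulliExp_const_mul] at hupper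
  have hdeg := bernoulliExp_sum_degree_le hp hp1 hn
    fun S => (outsideCore (SimpleGraph.fromEdgeSet (S : Set (Sym2 V))) r).toFinset
  have hX : (bernoulliExp (allEdges V) p fun S =>
      (#(outsideCore (SimpleGraph.fromEdgeSet (S : Set (Sym2 V))) r).toFinset : ℝ)) = x :=
    bernoulliExp_congr fun S _ => by rw [outsideCoreCard, Set.ncard_eq_toFinset_card']
  rw [hX] at hdeg
  have hrigid := bernoulliExp_card_rigidEdges_le (V := V) hp.le hp1 (by omega : 0 < r)
  have hsplit := bernoulliExp_mono hp.le hp1 (E := allEdges V) fun S _ =>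
    card_splitPairs_le (by omega : 0 < r) (SimpleGraph.fromEdgeSet (S : Set (Sym2 V)))
  rw [bernoulliExp_const_mul, bernoulliExp_add, bernoulliExp_const, bernoulliExp_const_mul,
    ← hx] at hsplit
  rw [← hnV, ← hs] at hlower
  rw [← hnV] at hsplit hdeg
  set m := bernoulliExp (allEdges V) p fun S =>
    (maxCutSize (SimpleGraph.fromEdgeSet (S : Set (Sym2 V))) r : ℝ)
  set R := bernoulliExp (allEdges V) p fun S =>
    (#(rigidEdges (SimpleGraph.fromEdgeSet (S : Set (Sym2 V))) r) : ℝ)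
  set Q := bernoulliExp (allEdges V) p fun S =>
    (#(splitPairs (SimpleGraph.fromEdgeSet (S : Set (Sym2 V))) r) : ℝ)
  have h1 : 2 * r * m ≤ p * ((r - 1) * n ^ 2 + 2 * n * x) +
      2 * r * ((1 + r ^ 2) * (2 * (n * p) * x + 2 * n)) := by
    have e1 := mul_le_mul_of_nonneg_left hsplit hp.le
    have e2 := mul_le_mul_of_nonneg_left hdeg (by positivity : (0 : ℝ) ≤ 1 + r ^ 2)
    have e3 : m ≤ p * Q + (1 + r ^ 2) * (2 * (n * p) * x + 2 * n) := by linarith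
    have e4 := mul_le_mul_of_nonneg_left e3 (by positivity : (0 : ℝ) ≤ 2 * r)
    linarith
  have h2 : (r - 1) * p * (n * (n - 1)) + n * s / 6 ≤ 2 * r * m := by
    have e1 := mul_le_mul_of_nonneg_left hlower (by positivity : (0 : ℝ) ≤ 2 * r)
    refine le_of_eq_of_le ?_ e1
    field_simp
    ring
  -- The leading terms `(r - 1) p n²` and `(r - 1) p n (n - 1)` cancel up to `(r - 1) p n`.
  have h3 : n * (s / 6) ≤ n * ((r - 1) * p + 2 * p * x + 4 * r * (1 + r ^ 2) * (p * x + 1)) := by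
    linarith
  have h4 := le_of_mul_le_mul_left h3 hn0
  have h5 : (r - 1) * p ≤ r := by nlinarith
  have h6 : 2 * (p * x) ≤ r * (p * x) := mul_le_mul_of_nonneg_right hr2 (by positivity)
  have h7 : s / 6 ≤ K + K * (p * x) := by
    rw [hK]
    linarith
  -- The constant term `K` is absorbed, since `K ≤ s / 12` by `hs12`; this is where the size
  -- assumption `hnp` is used.
  linarith

end MaxCut

end

theorem proposition2p13 (r : ℕ) (hr : 2 ≤ r) (δ : ℝ) (hδ : 0 < δ) :
    ∃ c : ℝ, 0 < c ∧ ∀ p : ℕ → unitInterval,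
      Filter.Tendsto (fun n : ℕ => (n : ℝ) * (p n : ℝ)) Filter.atTop Filter.atTop →
      (∀ᶠ n : ℕ in Filter.atTop, (p n : ℝ) ≤ 1 - δ) →
      ∀ᶠ n : ℕ in Filter.atTop,
        c * Real.sqrt ((n : ℝ) / (p n : ℝ)) ≤
          ∫ G, (MaxCut.outsideCoreCard G r : ℝ) ∂(SimpleGraph.binomialRandom (Fin n) (p n)) := by
  have hr0 : (0 : ℝ) < r := by positivity
  set K : ℝ := 4 * r * (1 + r ^ 2) + r with hK
  have hK0 : 0 < K := by positivity
  refine ⟨√(δ / (2 * r)) / (12 * K), by positivity, fun p hnp hpδ => ?_⟩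
  filter_upwards [hnp.eventually_ge_atTop ((12 * K) ^ 2 * (2 * r) / δ), hpδ,
    Filter.eventually_ge_atTop 2] with n hn hq hn2
  have hn0 : (0 : ℝ) < n := by exact_mod_cast (by omega : 0 < n)
  have hp : 0 < (p n : ℝ) := by
    have h : 0 < (n : ℝ) * p n := lt_of_lt_of_le (by positivity) hn
    exact pos_of_mul_pos_right h hn0.le
  -- `1 - p ≥ δ` replaces the variance by a constant multiple of `n p`, which tends to infinity.
  have hle : δ / (2 * r) * (n * p n) ≤ n * (p n * (1 - p n)) / (2 * r) := by
    rw [div_mul_eq_mul_div]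
    refine div_le_div_of_nonneg_right ?_ (by positivity)
    nlinarith [mul_le_mul_of_nonneg_left hq (mul_pos hn0 hp).le]
  have hbig : (12 * K) ^ 2 ≤ δ / (2 * r) * (n * p n) := by
    rw [div_le_iff₀ hδ] at hn
    rw [div_mul_eq_mul_div, le_div_iff₀ (by positivity)]
    linarith
  have h := MaxCut.sqrt_le_bernoulliExp_outsideCoreCard (V := Fin n) hp (p n).2.2 hr (by simpa)
    (by simpa using hbig.trans hle)
  rw [Fintype.card_fin, ← MaxCut.integral_binomialRandom (p n)
    fun G => (MaxCut.outsideCoreCard G r : ℝ)] at h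
  have h1 := (Real.sqrt_le_sqrt hle).trans h
  have h2 : √(δ / (2 * r) * (n * p n)) = √(δ / (2 * r)) * (√(n / p n) * p n) := by
    rw [Real.sqrt_mul (by positivity)]
    -- `√(n p) = p √(n / p)`, so dividing by `p` turns the bound on `p x` into the claimed one.
    congr 1
    rw [← Real.sqrt_sq hp.le, ← Real.sqrt_mul (by positivity), Real.sqrt_sq hp.le]
    congr 1
    field_simp
  rw [h2] at h1
  rw [div_mul_eq_mul_div, div_le_iff₀ (by positivity)]
  refine le_of_mul_le_mul_right ?_ hp
  linarith
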